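/- Let $d_1,d_2\in\mathbb N$, $d:=\min(d_1,d_2)$ and $\epsilon>0$. For $W\in\mathbb R^{d_1\times d_2}$ let $\sigma(W)=(\sigma_1(W),\dots,\sigma_d(W))$ be the vector of its singular values in non-increasing order, and for $v\in\mathbb R^d$ let $\operatorname{dg}(v)\in\mathbb R^{d_1\times d_2}$ be the rectangular diagonal matrix with $\operatorname{dg}(v)_{ii}=v_i$ and all other entries $0$. The $\epsilon$-smoothed log-determinant $F_\epsilon:\mathbb R^{d_1\times d_2}\to\mathbb R$ is $$F_\epsilon(W)=\sum_{i=1}^d f_\epsilon(\sigma_i(W)),\qquad f_\epsilon(\sigma)=\begin{cases}\epsilon^2(\log\sigma-\log\epsilon)+\tfrac12\epsilon^2,&\sigma\ge\epsilon,\\ \tfrac12\sigma^2,&\sigma<\epsilon.\end{cases}$$ Equip $\mathbb R^{d_1\times d_2}$ with the Frobenius inner product $\langle A,B\rangle=\operatorname{tr}(A^\top B)$ and the Frobenius norm. Then $F_\epsilon$ is (Fréchet) differentiable on $\mathbb R^{d_1\times d_2}$, its gradient $\nabla F_\epsilon:\mathbb R^{d_1\times d_2}\to\mathbb R^{d_1\times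 d_2}$ is $1$-Lipschitz, and for every $W$ and every singular value decomposition $W=U\operatorname{dg}(\sigma(W))V^\top$ with orthogonal $U\in\mathbb R^{d_1\times d_1}$, $V\in\mathbb R^{d_2\times d_2}$, $$\nabla F_\epsilon(W)=U\operatorname{dg}\!\left(\left(\frac{\sigma_i(W)}{\max(\sigma_i(W)/\epsilon,1)^2}\right)_{i=1}^d\right)V^\top .$$ -/

import Mathlib

open scoped Matrix.Norms.Frobenius Gradient

/-- The Frobenius inner product `⟨A, B⟩ = tr(Aᵀ B)` on real `d₁ × d₂` matrices. The norm it induces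
is Mathlib's Frobenius norm, which is the one in force here. -/
noncomputable instance frobeniusInnerProductSpace (d₁ d₂ : ℕ) :
    InnerProductSpace ℝ (Matrix (Fin d₁) (Fin d₂) ℝ) where
  inner A B := (A.transpose * B).trace
  norm_sq_eq_re_inner A := by
    rw [Matrix.frobenius_norm_def, ← Real.sqrt_eq_rpow, Real.sq_sqrt (by positivity)]
    simp only [Matrix.trace, Matrix.diag, Matrix.mul_apply, Matrix.transpose_apply,
      RCLike.re_to_real]
    rw [Finset.sum_comm]
    simp [← pow_two]
  conj_inner_symm A B := by
    simp only [conj_trivial]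
    rw [← Matrix.trace_transpose, Matrix.transpose_mul, Matrix.transpose_transpose]
  add_left A B C := by
    simp [Matrix.transpose_add, Matrix.add_mul, Matrix.trace_add]
  smul_left A B r := by
    simp [Matrix.transpose_smul, Matrix.trace_smul]

instance frobeniusCompleteSpace (d₁ d₂ : ℕ) : CompleteSpace (Matrix (Fin d₁) (Fin d₂) ℝ) :=
  FiniteDimensional.complete ℝ _

/-- The vector `σ(W) = (σ₁(W), …, σ_d(W))`, `d = min(d₁, d₂)`, of the singular values of `W` in
non-increasing order, with multiplicity (indices start at `0`). -/
noncomputable def singularValueVector {d₁ d₂ : ℕ} (W : Matrix (Fin d₁) (Fin d₂) ℝ) :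
    Fin (min d₁ d₂) → ℝ :=
  fun i => (Matrix.toEuclideanLin W).singularValues i

/-- The scalar function `f_ε`. -/
noncomputable def smoothedLog (ε s : ℝ) : ℝ :=
  if ε ≤ s then ε ^ 2 * (Real.log s - Real.log ε) + 1 / 2 * ε ^ 2 else 1 / 2 * s ^ 2

/-- The `ε`-smoothed log-determinant `F_ε(W) = ∑ᵢ f_ε(σᵢ(W))`. -/
noncomputable def smoothedLogDet {d₁ d₂ : ℕ} (ε : ℝ) (W : Matrix (Fin d₁) (Fin d₂) ℝ) : ℝ :=
  ∑ i : Fin (min d₁ d₂), smoothedLog ε (singularValueVector W i)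

/-- The rectangular diagonal `d₁ × d₂` matrix `dg(v)` of a vector `v` of length `min(d₁, d₂)`. -/
def rectDiagonal {d₁ d₂ : ℕ} (v : Fin (min d₁ d₂) → ℝ) : Matrix (Fin d₁) (Fin d₂) ℝ :=
  Matrix.of fun i j =>
    if h : (i : ℕ) = (j : ℕ) then v ⟨i, lt_min i.isLt (h ▸ j.isLt)⟩ else 0

/-- `W = U dg(σ(W)) Vᵀ` is a (full) singular value decomposition of `W`. -/
def IsSVD {d₁ d₂ : ℕ} (W : Matrix (Fin d₁) (Fin d₂) ℝ) (U : Matrix (Fin d₁) (Fin d₁) ℝ)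
    (V : Matrix (Fin d₂) (Fin d₂) ℝ) : Prop :=
  U ∈ Matrix.orthogonalGroup (Fin d₁) ℝ ∧ V ∈ Matrix.orthogonalGroup (Fin d₂) ℝ ∧
    W = U * rectDiagonal (singularValueVector W) * V.transpose

/-! ### Consequences of a two-sided quadratic bound. -/

section QuadraticBounds

variable {E : Type*} [NormedAddCommGroup E] [InnerProductSpace ℝ E] {F : E → ℝ} {G : E → E}

open scoped RealInnerProductSpace

/-! Everything follows from |F(Z) - F(W) - ⟪G(W), Z - W⟫| ≤ ½‖Z - W‖², where G(W) applies f_ε' to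
the singular values of W: such a bound forces G = ∇F and makes G 1-Lipschitz. The bound is the
tangent inequality for ½‖·‖² ± F, the sum of φ(σᵢ) with φ(s) = ½s² ± f_ε(s). As f_ε' is 1-Lipschitz
and f_ε'(0) = 0, φ is convex, and nondecreasing on s ≥ 0. `IsSingularSystem.sum_tangent_le` lifts
the scalar tangent inequality to matrices: the overlaps of two systems of singular vectors form a
doubly substochastic matrix. No ordering of the singular values is needed, and any SVD of W may
serve, so the gradient formula holds for all of them. -/

theorem hasGradientAt_of_abs_sub_sub_inner_le [CompleteSpace E] {x g : E} {C : ℝ}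
    (h : ∀ y, |F y - F x - ⟪g, y - x⟫| ≤ C * ‖y - x‖ ^ 2) : HasGradientAt F g x := by
  rw [hasGradientAt_iff_hasFDerivAt, hasFDerivAt_iff_isLittleO]
  have hO : (fun y => F y - F x - (InnerProductSpace.toDual ℝ E g) (y - x)) =O[nhds x]
      fun y => ‖y - x‖ ^ 2 := by
    refine Asymptotics.IsBigO.of_bound C (Filter.Eventually.of_forall fun y => ?_)
    simpa using h y
  refine hO.trans_isLittleO ?_
  have h2 : (fun z : E => ‖z‖ ^ 2) =o[nhds 0] fun z : E => z := by
    simpa using (Asymptotics.isLittleO_norm_pow_id (E' := E) (n := 2) (by norm_num))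
  refine h2.comp_tendsto (k := fun y => y - x) ?_
  exact (continuous_id.sub continuous_const).tendsto' x 0 (by simp)

theorem lipschitzWith_one_of_abs_sub_sub_inner_le
    (h : ∀ x y, |F y - F x - ⟪G x, y - x⟫| ≤ 1 / 2 * ‖y - x‖ ^ 2) : LipschitzWith 1 G := by
  have key : ∀ x y, F y - F x ≤ ⟪G y, y - x⟫ - 1 / 4 * ⟪G y - G x, G y - G x⟫
      - 1 / 2 * ⟪G y - G x, y - x⟫ + 1 / 4 * ⟪y - x, y - x⟫ := by
    intro x y
    -- Compare the upper bound for `F z` from `x` with the lower bound from `y`; this `z` makes the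
    -- result sharpest.
    obtain ⟨z, hz⟩ : ∃ z, z = x + (1 / 2 : ℝ) • ((G y - G x) + (y - x)) := ⟨_, rfl⟩
    have h1 := (abs_le.1 (h x z)).2
    have h2 := (abs_le.1 (h y z)).1
    have e1 : z - x = (1 / 2 : ℝ) • ((G y - G x) + (y - x)) := by rw [hz]; abel
    have e2 : z - y = (1 / 2 : ℝ) • ((G y - G x) - (y - x)) := by rw [hz]; module
    have e3 : G x = G y - (G y - G x) := by abel
    rw [e1, e3] at h1
    rw [e2] at h2
    generalize y - x = d at *
    generalize G y - G x = a at *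
    simp only [← real_inner_self_eq_norm_sq, inner_add_left, inner_add_right, inner_sub_left,
      inner_sub_right, inner_smul_left, inner_smul_right, real_inner_comm d a,
      conj_trivial] at h1 h2 ⊢
    linarith
  refine LipschitzWith.of_dist_le_mul fun x y => ?_
  rw [dist_comm, dist_comm x, dist_eq_norm, dist_eq_norm, NNReal.coe_one, one_mul]
  have h1 := key x y
  have h2 := key y x
  -- Adding the two instances cancels `F` and the cross terms.
  have h3 : ‖G y - G x‖ ^ 2 ≤ ‖y - x‖ ^ 2 := by
    rw [← real_inner_self_eq_norm_sq, ← real_inner_self_eq_norm_sq]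
    simp only [inner_sub_left, inner_sub_right] at h1 h2 ⊢
    linarith
  exact (sq_le_sq₀ (norm_nonneg _) (norm_nonneg _)).1 h3

end QuadraticBounds

/-! ### The scalar function and its derivative. -/

section Scalar

/-- The derivative of `smoothedLog ε`. -/
noncomputable def smoothedLogDeriv (ε s : ℝ) : ℝ :=
  s / (max (s / ε) 1) ^ 2

variable {ε s t : ℝ}

theorem smoothedLogDeriv_of_le (hε : 0 < ε) (h : s ≤ ε) : smoothedLogDeriv ε s = s := by
  rw [smoothedLogDeriv, max_eq_right ((div_le_one hε).2 h)]
  simp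

theorem smoothedLogDeriv_of_ge (hε : 0 < ε) (h : ε ≤ s) : smoothedLogDeriv ε s = ε ^ 2 / s := by
  have : 0 < s := hε.trans_le h
  rw [smoothedLogDeriv, max_eq_left ((one_le_div hε).2 h)]
  field_simp

theorem smoothedLog_of_le (h : s ≤ ε) : smoothedLog ε s = 1 / 2 * s ^ 2 := by
  unfold smoothedLog
  split_ifs with h'
  · rw [le_antisymm h h']; ring
  · rfl

theorem smoothedLog_of_ge (h : ε ≤ s) :
    smoothedLog ε s = ε ^ 2 * (Real.log s - Real.log ε) + 1 / 2 * ε ^ 2 := if_pos h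

theorem hasDerivAt_smoothedLog (hε : 0 < ε) (s : ℝ) :
    HasDerivAt (smoothedLog ε) (smoothedLogDeriv ε s) s := by
  have hq : HasDerivAt (fun x : ℝ => 1 / 2 * x ^ 2) s s :=
    ((hasDerivAt_pow 2 s).const_mul (1 / 2 : ℝ)).congr_deriv (by simp)
  have hl : 0 < s → HasDerivAt
      (fun x : ℝ => ε ^ 2 * (Real.log x - Real.log ε) + 1 / 2 * ε ^ 2) (ε ^ 2 / s) s := fun h =>
    (((Real.hasDerivAt_log h.ne').sub_const _).const_mul _).add_const _
  rcases lt_trichotomy s ε with h | h | h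
  · rw [smoothedLogDeriv_of_le hε h.le]
    refine hq.congr_of_eventuallyEq ?_
    filter_upwards [Iio_mem_nhds h] with x hx using smoothedLog_of_le (le_of_lt hx)
  · have h1 : HasDerivWithinAt (smoothedLog ε) (smoothedLogDeriv ε s) (Set.Iic ε) s := by
      rw [smoothedLogDeriv_of_le hε h.le]
      exact hq.hasDerivWithinAt.congr (fun x hx => smoothedLog_of_le hx)
        (smoothedLog_of_le h.le)
    have h2 : HasDerivWithinAt (smoothedLog ε) (smoothedLogDeriv ε s) (Set.Ici ε) s := by
      rw [smoothedLogDeriv_of_ge hε h.ge]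
      exact (hl (h ▸ hε)).hasDerivWithinAt.congr (fun x hx => smoothedLog_of_ge hx)
        (smoothedLog_of_ge h.ge)
    have h3 := h1.union h2
    rwa [Set.Iic_union_Ici, hasDerivWithinAt_univ] at h3
  · rw [smoothedLogDeriv_of_ge hε h.le]
    refine (hl (hε.trans h)).congr_of_eventuallyEq ?_
    filter_upwards [Ioi_mem_nhds h] with x hx using smoothedLog_of_ge (le_of_lt hx)

theorem smoothedLogDeriv_nonneg (hs : 0 ≤ s) : 0 ≤ smoothedLogDeriv ε s := by
  unfold smoothedLogDeriv; positivity

theorem abs_smoothedLogDeriv_sub_le (hε : 0 < ε) (hst : s ≤ t) :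
    |smoothedLogDeriv ε t - smoothedLogDeriv ε s| ≤ t - s := by
  have hlog : ∀ {a b : ℝ}, ε ≤ a → a ≤ b → |ε ^ 2 / b - ε ^ 2 / a| ≤ b - a := by
    intro a b ha hab
    have ha0 : 0 < a := hε.trans_le ha
    have hb0 : 0 < b := ha0.trans_le hab
    have e : ε ^ 2 / b - ε ^ 2 / a = -((b - a) * (ε ^ 2 / (a * b))) := by field_simp; ring
    have hle : ε ^ 2 / (a * b) ≤ 1 := by
      rw [div_le_one (by positivity)]; nlinarith
    rw [e, abs_neg, abs_of_nonneg (mul_nonneg (sub_nonneg.2 hab) (by positivity))]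
    exact mul_le_of_le_one_right (sub_nonneg.2 hab) hle
  rcases le_total t ε with h | h
  · rw [smoothedLogDeriv_of_le hε h, smoothedLogDeriv_of_le hε (hst.trans h),
      abs_of_nonneg (sub_nonneg.2 hst)]
  rcases le_total s ε with h' | h'
  · rw [smoothedLogDeriv_of_ge hε h, smoothedLogDeriv_of_le hε h']
    have := hlog le_rfl h
    have e : ε ^ 2 / ε = ε := by field_simp
    rw [e] at this
    calc |ε ^ 2 / t - s| = |(ε ^ 2 / t - ε) + (ε - s)| := by congr 1; ring
      _ ≤ |ε ^ 2 / t - ε| + |ε - s| := abs_add_le _ _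
      _ ≤ (t - ε) + (ε - s) := by
        rw [abs_of_nonneg (sub_nonneg.2 h')]; gcongr
      _ = t - s := by ring
  · rw [smoothedLogDeriv_of_ge hε h, smoothedLogDeriv_of_ge hε h']
    exact hlog h' hst

theorem add_mul_sub_le_of_monotone_deriv {φ φ' : ℝ → ℝ} (hφ : ∀ x, HasDerivAt φ (φ' x) x)
    (hm : Monotone φ') (s t : ℝ) : φ s + φ' s * (t - s) ≤ φ t := by
  have hc : Continuous φ := continuous_iff_continuousAt.2 fun x => (hφ x).continuousAt
  rcases lt_trichotomy s t with h | rfl | h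
  · obtain ⟨c, hcm, hce⟩ := exists_hasDerivAt_eq_slope φ φ' h hc.continuousOn fun x _ => hφ x
    rw [eq_div_iff (sub_pos.2 h).ne'] at hce
    nlinarith [hm hcm.1.le]
  · simp
  · obtain ⟨c, hcm, hce⟩ := exists_hasDerivAt_eq_slope φ φ' h hc.continuousOn fun x _ => hφ x
    rw [eq_div_iff (sub_pos.2 h).ne'] at hce
    nlinarith [hm hcm.2.le]

/-- The slope of `s` dominates that of `c * smoothedLogDeriv ε s`, so the derivative is monotone.
The values `c = 1` and `c = -1` will give the two sides of the quadratic bound. -/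
theorem half_sq_add_smul_smoothedLog_tangent (hε : 0 < ε) {c : ℝ} (hc : |c| ≤ 1) (s t : ℝ) :
    (1 / 2 * s ^ 2 + c * smoothedLog ε s) + (s + c * smoothedLogDeriv ε s) * (t - s) ≤
      1 / 2 * t ^ 2 + c * smoothedLog ε t := by
  refine add_mul_sub_le_of_monotone_deriv (φ := fun s => 1 / 2 * s ^ 2 + c * smoothedLog ε s)
    (φ' := fun s => s + c * smoothedLogDeriv ε s) (fun x => ?_) (fun x y hxy => ?_) s t
  · exact (((hasDerivAt_pow 2 x).const_mul (1 / 2 : ℝ)).congr_deriv (by simp)).add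
      ((hasDerivAt_smoothedLog hε x).const_mul c)
  · have h1 := abs_smoothedLogDeriv_sub_le hε hxy
    have h2 : |c * (smoothedLogDeriv ε y - smoothedLogDeriv ε x)| ≤ y - x := by
      rw [abs_mul]
      exact (mul_le_of_le_one_left (abs_nonneg _) hc).trans h1
    have h3 := (abs_le.1 h2).1
    simp only
    linarith

theorem half_sq_add_smul_smoothedLogDeriv_nonneg (hε : 0 < ε) {c : ℝ} (hc : |c| ≤ 1)
    (hs : 0 ≤ s) : 0 ≤ s + c * smoothedLogDeriv ε s := by
  have h1 := abs_smoothedLogDeriv_sub_le hε hs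
  rw [smoothedLogDeriv_of_le hε hε.le, sub_zero, sub_zero] at h1
  have h2 : |c * smoothedLogDeriv ε s| ≤ s := by
    rw [abs_mul]
    exact (mul_le_of_le_one_left (abs_nonneg _) hc).trans h1
  linarith [(abs_le.1 h2).1]

end Scalar


open Matrix

/-! ### Singular systems and the spectral tangent inequality. -/

section SingularSystem

variable {ι κ m n : Type*} [Fintype ι] [Fintype κ] [Fintype m] [Fintype n]

/-- The finite family `u` satisfies Bessel's inequality. -/
def IsBessel (u : ι → m → ℝ) : Prop :=
  ∀ x : m → ℝ, ∑ i, (u i ⬝ᵥ x) ^ 2 ≤ x ⬝ᵥ x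

theorem IsBessel.dotProduct_self_le_one {u : ι → m → ℝ} (hu : IsBessel u) (i : ι) :
    u i ⬝ᵥ u i ≤ 1 := by
  have h1 : (u i ⬝ᵥ u i) ^ 2 ≤ u i ⬝ᵥ u i :=
    (Finset.single_le_sum (f := fun j => (u j ⬝ᵥ u i) ^ 2) (fun _ _ => sq_nonneg _)
      (Finset.mem_univ i)).trans (hu (u i))
  nlinarith

/-- A singular system `(s, u, v)` of the matrix `W`: the triples of a singular value decomposition,
where the singular vectors that belong to the singular value `0` may be replaced by zero. -/
structure IsSingularSystem (W : Matrix m n ℝ) (s : ι → ℝ) (u : ι → m → ℝ) (v : ι → n → ℝ) :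
    Prop where
  nonneg : ∀ i, 0 ≤ s i
  bessel_left : IsBessel u
  bessel_right : IsBessel v
  eq_sum : W = ∑ i, s i • vecMulVec (u i) (v i)
  dotProduct_mulVec : ∀ i, u i ⬝ᵥ W *ᵥ v i = s i

theorem dotProduct_sum_smul_vecMulVec_mulVec (t : κ → ℝ) (p : κ → m → ℝ) (q : κ → n → ℝ)
    (x : m → ℝ) (y : n → ℝ) :
    x ⬝ᵥ (∑ k, t k • vecMulVec (p k) (q k)) *ᵥ y = ∑ k, t k * ((p k ⬝ᵥ x) * (q k ⬝ᵥ y)) := by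
  rw [sum_mulVec, dotProduct_sum]
  refine Finset.sum_congr rfl fun k _ => ?_
  rw [smul_mulVec, vecMulVec_mulVec, dotProduct_smul, dotProduct_comm x]
  simp [dotProduct_comm (p k) x, mul_comm]

theorem IsSingularSystem.sum_tangent_le {W Z : Matrix m n ℝ} {s : ι → ℝ} {u : ι → m → ℝ}
    {v : ι → n → ℝ} {t : κ → ℝ} {p : κ → m → ℝ} {q : κ → n → ℝ} (hW : IsSingularSystem W s u v)
    (hZ : IsSingularSystem Z t p q) {φ φ' : ℝ → ℝ} (h0 : φ 0 = 0) (h0' : ∀ x, 0 ≤ x → 0 ≤ φ' x)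
    (hφ : ∀ x y, 0 ≤ x → 0 ≤ y → φ x + φ' x * (y - x) ≤ φ y) :
    ∑ i, φ (s i) + ∑ i, φ' (s i) * (u i ⬝ᵥ Z *ᵥ v i - s i) ≤ ∑ k, φ (t k) := by
  have hpos : ∀ x, 0 ≤ x → 0 ≤ φ x := fun x hx => by
    have := hφ 0 x le_rfl hx
    nlinarith [mul_nonneg (h0' 0 le_rfl) hx]
  -- By AM-GM, `S i k` dominates (pₖ·uᵢ)(qₖ·vᵢ), the coefficient of `t k` in uᵢ·Zvᵢ; Bessel bounds
  -- its row and column sums by 1.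
  set S : ι → κ → ℝ := fun i k => 1 / 2 * ((p k ⬝ᵥ u i) ^ 2 + (q k ⬝ᵥ v i) ^ 2) with hS
  have hrow : ∀ i, ∑ k, S i k ≤ 1 := fun i => by
    simp only [hS]
    rw [← Finset.mul_sum, Finset.sum_add_distrib]
    linarith [hZ.bessel_left (u i), hZ.bessel_right (v i), hW.bessel_left.dotProduct_self_le_one i,
      hW.bessel_right.dotProduct_self_le_one i]
  have hcol : ∀ k, ∑ i, S i k ≤ 1 := fun k => by
    simp only [hS, dotProduct_comm (p k), dotProduct_comm (q k)]
    rw [← Finset.mul_sum, Finset.sum_add_distrib]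
    linarith [hW.bessel_left (p k), hW.bessel_right (q k), hZ.bessel_left.dotProduct_self_le_one k,
      hZ.bessel_right.dotProduct_self_le_one k]
  have hS0 : ∀ i k, 0 ≤ S i k := fun i k => by simp only [hS]; positivity
  have hi : ∀ i, φ (s i) + φ' (s i) * (u i ⬝ᵥ Z *ᵥ v i - s i) ≤ ∑ k, S i k * φ (t k) := fun i => by
    have h1 : u i ⬝ᵥ Z *ᵥ v i ≤ ∑ k, S i k * t k := by
      rw [hZ.eq_sum, dotProduct_sum_smul_vecMulVec_mulVec]
      refine Finset.sum_le_sum fun k _ => ?_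
      rw [mul_comm]
      refine mul_le_mul_of_nonneg_right ?_ (hZ.nonneg k)
      simp only [hS]
      nlinarith [sq_nonneg (p k ⬝ᵥ u i - q k ⬝ᵥ v i)]
    have h2 : ∑ k, S i k * (φ (s i) + φ' (s i) * (t k - s i)) ≤ ∑ k, S i k * φ (t k) :=
      Finset.sum_le_sum fun k _ =>
        mul_le_mul_of_nonneg_left (hφ _ _ (hW.nonneg i) (hZ.nonneg k)) (hS0 i k)
    have h3 : ∑ k, S i k * (φ (s i) + φ' (s i) * (t k - s i)) =
        (∑ k, S i k) * (φ (s i) - φ' (s i) * s i) + φ' (s i) * ∑ k, S i k * t k := by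
      rw [Finset.sum_mul, Finset.mul_sum, ← Finset.sum_add_distrib]
      exact Finset.sum_congr rfl fun k _ => by ring
    -- The tangent at `s i` has value at most `φ 0 = 0` at the origin, so a row sum below 1 does no
    -- harm.
    have h4 := hφ _ _ (hW.nonneg i) le_rfl
    have h5 := mul_le_mul_of_nonneg_left h1 (h0' _ (hW.nonneg i))
    have h6 := mul_nonneg (sub_nonneg.2 (hrow i))
      (show 0 ≤ -(φ (s i) - φ' (s i) * s i) by linarith)
    linarith
  calc ∑ i, φ (s i) + ∑ i, φ' (s i) * (u i ⬝ᵥ Z *ᵥ v i - s i)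
      = ∑ i, (φ (s i) + φ' (s i) * (u i ⬝ᵥ Z *ᵥ v i - s i)) := Finset.sum_add_distrib.symm
    _ ≤ ∑ i, ∑ k, S i k * φ (t k) := Finset.sum_le_sum fun i _ => hi i
    _ = ∑ k, (∑ i, S i k) * φ (t k) := by
      rw [Finset.sum_comm]; simp only [Finset.sum_mul]
    _ ≤ ∑ k, φ (t k) := Finset.sum_le_sum fun k _ =>
      mul_le_of_le_one_left (hpos _ (hZ.nonneg k)) (hcol k)

end SingularSystem

/-! ### The quadratic bound in the Frobenius norm. -/

section Frobenius

variable {d₁ d₂ : ℕ} {ι κ : Type*} [Fintype ι] [Fintype κ]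

open scoped RealInnerProductSpace

theorem frobenius_inner_def (A B : Matrix (Fin d₁) (Fin d₂) ℝ) : ⟪A, B⟫ = (Aᵀ * B).trace := rfl

theorem frobenius_inner_vecMulVec (u : Fin d₁ → ℝ) (v : Fin d₂ → ℝ)
    (Z : Matrix (Fin d₁) (Fin d₂) ℝ) : ⟪vecMulVec u v, Z⟫ = u ⬝ᵥ Z *ᵥ v := by
  rw [frobenius_inner_def, transpose_vecMulVec, vecMulVec_mul, trace_vecMulVec,
    dotProduct_mulVec, dotProduct_comm]

variable {W Z : Matrix (Fin d₁) (Fin d₂) ℝ} {s : ι → ℝ} {u : ι → Fin d₁ → ℝ}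
  {v : ι → Fin d₂ → ℝ}

theorem frobenius_inner_sum_smul_vecMulVec (a : ι → ℝ) (u : ι → Fin d₁ → ℝ)
    (v : ι → Fin d₂ → ℝ) (Z : Matrix (Fin d₁) (Fin d₂) ℝ) :
    ⟪∑ i, a i • vecMulVec (u i) (v i), Z⟫ = ∑ i, a i * (u i ⬝ᵥ Z *ᵥ v i) := by
  simp [sum_inner, real_inner_smul_left, frobenius_inner_vecMulVec]

theorem IsSingularSystem.norm_sq (hW : IsSingularSystem W s u v) : ‖W‖ ^ 2 = ∑ i, s i ^ 2 := by
  rw [← real_inner_self_eq_norm_sq]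
  nth_rw 1 [hW.eq_sum]
  rw [frobenius_inner_sum_smul_vecMulVec]
  exact Finset.sum_congr rfl fun i _ => by rw [hW.dotProduct_mulVec, sq]

theorem IsSingularSystem.abs_sum_smoothedLog_sub_le {ε : ℝ} (hε : 0 < ε) {t : κ → ℝ}
    {p : κ → Fin d₁ → ℝ} {q : κ → Fin d₂ → ℝ} (hW : IsSingularSystem W s u v)
    (hZ : IsSingularSystem Z t p q) :
    |∑ k, smoothedLog ε (t k) - ∑ i, smoothedLog ε (s i) -
      ⟪∑ i, smoothedLogDeriv ε (s i) • vecMulVec (u i) (v i), Z - W⟫| ≤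
      1 / 2 * ‖Z - W‖ ^ 2 := by
  have key : ∀ c : ℝ, |c| ≤ 1 → -(1 / 2 * ‖Z - W‖ ^ 2) ≤
      c * (∑ k, smoothedLog ε (t k) - ∑ i, smoothedLog ε (s i) -
        ⟪∑ i, smoothedLogDeriv ε (s i) • vecMulVec (u i) (v i), Z - W⟫) := by
    intro c hc
    have h := hW.sum_tangent_le hZ (φ := fun s => 1 / 2 * s ^ 2 + c * smoothedLog ε s)
      (φ' := fun s => s + c * smoothedLogDeriv ε s)
      (by simp [smoothedLog_of_le hε.le])
      (fun x hx => half_sq_add_smul_smoothedLogDeriv_nonneg hε hc hx)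
      (fun x y _ _ => half_sq_add_smul_smoothedLog_tangent hε hc x y)
    have e1 : ⟪W, Z⟫ = ∑ i, s i * (u i ⬝ᵥ Z *ᵥ v i) := by
      nth_rw 1 [hW.eq_sum]
      exact frobenius_inner_sum_smul_vecMulVec _ _ _ _
    rw [inner_sub_right, frobenius_inner_sum_smul_vecMulVec, frobenius_inner_sum_smul_vecMulVec,
      norm_sub_sq_real, real_inner_comm, e1, hW.norm_sq, hZ.norm_sq]
    simp only [hW.dotProduct_mulVec]
    have e2 : ∑ i, (s i + c * smoothedLogDeriv ε (s i)) * (u i ⬝ᵥ Z *ᵥ v i - s i) =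
        ∑ i, s i * (u i ⬝ᵥ Z *ᵥ v i) - ∑ i, s i ^ 2 +
        c * (∑ i, smoothedLogDeriv ε (s i) * (u i ⬝ᵥ Z *ᵥ v i) -
          ∑ i, smoothedLogDeriv ε (s i) * s i) := by
      simp only [mul_sub, Finset.mul_sum, ← Finset.sum_sub_distrib, ← Finset.sum_add_distrib]
      exact Finset.sum_congr rfl fun i _ => by ring
    simp only [Finset.sum_add_distrib, ← Finset.mul_sum] at h
    rw [e2] at h
    linarith
  have h1 := key 1 (by simp)
  have h2 := key (-1) (by simp)
  exact abs_le.2 ⟨by linarith, by linarith⟩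

end Frobenius

/-! ### Singular systems from eigenvectors of WᵀW and from SVDs. -/

section Existence

variable {ι m : Type*} [Fintype ι] [Fintype m]

/-- Norms below 1 are allowed so that zero vectors can stand in for missing left singular vectors.
-/
theorem isBessel_of_dotProduct_eq_zero {u : ι → m → ℝ}
    (ho : ∀ i j, i ≠ j → u i ⬝ᵥ u j = 0) (hn : ∀ i, u i ⬝ᵥ u i ≤ 1) : IsBessel u := by
  intro x
  set y : m → ℝ := ∑ i, (u i ⬝ᵥ x) • u i with hy
  have h0 : 0 ≤ (x - y) ⬝ᵥ (x - y) := by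
    simpa using dotProduct_star_self_nonneg (x - y)
  have hxy : x ⬝ᵥ y = ∑ i, (u i ⬝ᵥ x) ^ 2 := by
    rw [hy, dotProduct_sum]
    exact Finset.sum_congr rfl fun i _ => by rw [dotProduct_smul, dotProduct_comm x, smul_eq_mul, sq]
  have huy : ∀ i, u i ⬝ᵥ y = (u i ⬝ᵥ x) * (u i ⬝ᵥ u i) := fun i => by
    rw [hy, dotProduct_sum, Finset.sum_eq_single i]
    · simp
    · intro j _ hj; rw [dotProduct_smul, ho i j hj.symm, smul_zero]
    · simp
  have hyy : y ⬝ᵥ y ≤ ∑ i, (u i ⬝ᵥ x) ^ 2 := by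
    nth_rw 1 [hy]
    rw [sum_dotProduct]
    refine Finset.sum_le_sum fun i _ => ?_
    rw [smul_dotProduct, huy, smul_eq_mul]
    nlinarith [hn i, sq_nonneg (u i ⬝ᵥ x)]
  simp only [sub_dotProduct, dotProduct_sub, dotProduct_comm y x] at h0
  linarith

variable {d₁ d₂ : ℕ}

theorem exists_isSingularSystem (W : Matrix (Fin d₁) (Fin d₂) ℝ) :
    ∃ (u : Fin (min d₁ d₂) → Fin d₁ → ℝ) (v : Fin (min d₁ d₂) → Fin d₂ → ℝ),
      IsSingularSystem W (singularValueVector W) u v := by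
  obtain ⟨b, hb0, hb1, hbb, hW0, hWW⟩ : ∃ b : Fin d₂ → Fin d₂ → ℝ,
      (∀ i j, i ≠ j → b i ⬝ᵥ b j = 0) ∧ (∀ i, b i ⬝ᵥ b i = 1) ∧
      (∀ A B : Matrix (Fin d₁) (Fin d₂) ℝ, (∀ i, A *ᵥ b i = B *ᵥ b i) → A = B) ∧
      (∀ i j, i ≠ j → (W *ᵥ b i) ⬝ᵥ (W *ᵥ b j) = 0) ∧
      ∀ i, (W *ᵥ b i) ⬝ᵥ (W *ᵥ b i) = (toEuclideanLin W).singularValues i ^ 2 := by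
    set T := toEuclideanLin W with hT
    have hf : Module.finrank ℝ (EuclideanSpace ℝ (Fin d₂)) = d₂ := by simp
    set b := T.isSymmetric_adjoint_comp_self.eigenvectorBasis hf with hb
    have hdot : ∀ i j, (b i).ofLp ⬝ᵥ (b j).ofLp = inner ℝ (b i) (b j) := fun i j => by
      rw [EuclideanSpace.inner_eq_star_dotProduct, dotProduct_comm]; simp
    have hTb : ∀ i j, (W *ᵥ (b i).ofLp) ⬝ᵥ (W *ᵥ (b j).ofLp) =
        T.singularValues j ^ 2 * inner ℝ (b i) (b j) := fun i j => by
      have h1 : (W *ᵥ (b i).ofLp) ⬝ᵥ (W *ᵥ (b j).ofLp) = inner ℝ (T (b i)) (T (b j)) := by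
        rw [EuclideanSpace.inner_eq_star_dotProduct, dotProduct_comm, hT]
        simp
      rw [h1, ← LinearMap.adjoint_inner_right, ← LinearMap.comp_apply, hb,
        LinearMap.IsSymmetric.apply_eigenvectorBasis, inner_smul_right,
        T.sq_singularValues_fin hf]
      simp
    refine ⟨fun i => (b i).ofLp, fun i j hij => ?_, fun i => ?_, fun A B h => ?_,
      fun i j hij => ?_, fun i => ?_⟩
    · rw [hdot, b.orthonormal.2 hij]
    · rw [hdot, real_inner_self_eq_norm_sq, b.orthonormal.1]; simp
    · apply toEuclideanLin.injective
      refine b.toBasis.ext fun i => ?_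
      simp [toLpLin_apply, h i]
    · rw [hTb, b.orthonormal.2 hij, mul_zero]
    · rw [hTb, real_inner_self_eq_norm_sq, b.orthonormal.1]; simp
  set s := (toEuclideanLin W).singularValues with hs
  have hz : ∀ i : Fin d₂, s i = 0 → W *ᵥ b i = 0 := fun i hi => by
    rw [← dotProduct_self_eq_zero, hWW, hi]; simp
  -- If `d₁ < d₂`, the eigenvectors beyond the first `d₁` are killed by `W`, so `min d₁ d₂` terms
  -- suffice.
  have hrank : ∀ i : ℕ, d₁ ≤ i → s i = 0 := fun i hi => by
    rw [hs, LinearMap.singularValues_eq_zero_iff_le_finrank_range]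
    refine (Submodule.finrank_le _).trans ?_
    simpa using hi
  let c : Fin (min d₁ d₂) → Fin d₂ := Fin.castLE (min_le_right _ _)
  have hc : Function.Injective c := Fin.castLE_injective _
  have hsc : ∀ i, singularValueVector W i = s (c i) := fun i => rfl
  have hv : IsBessel fun i => b (c i) := isBessel_of_dotProduct_eq_zero
    (fun i j hij => hb0 _ _ (hc.ne hij)) (fun i => (hb1 _).le)
  have hsm : ∀ i : Fin d₂, s i • (s i)⁻¹ • W *ᵥ b i = W *ᵥ b i := fun i => by
    by_cases h : s i = 0
    · rw [hz i h]; simp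
    · rw [smul_smul, mul_inv_cancel₀ h, one_smul]
  -- Since `0⁻¹ = 0`, the left vector vanishes when the singular value does.
  refine ⟨fun i => (s (c i))⁻¹ • W *ᵥ b (c i), fun i => b (c i), ?_, ?_, hv, ?_, ?_⟩
  · exact fun i => LinearMap.singularValues_nonneg _ _
  · refine isBessel_of_dotProduct_eq_zero (fun i j hij => ?_) fun i => ?_
    · simp [hW0 _ _ (hc.ne hij)]
    · by_cases h : s (c i) = 0
      · simp [h]
      · simp only [smul_dotProduct, dotProduct_smul, hWW, smul_eq_mul]
        field_simp; rfl
  · refine hbb _ _ fun j => ?_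
    simp only [sum_mulVec, smul_mulVec, vecMulVec_mulVec, hsc]
    by_cases hj : (j : ℕ) < d₁
    · have hcj : c ⟨j, lt_min hj j.2⟩ = j := rfl
      rw [Finset.sum_eq_single ⟨j, lt_min hj j.2⟩]
      · rw [hcj, hb1]; simp [hsm]
      · intro i _ hi
        rw [hb0 _ _ (fun h => hi (hc (h.trans hcj.symm)))]; simp
      · simp
    · rw [hz j (hrank j (not_lt.1 hj)), Finset.sum_eq_zero]
      intro i _
      rw [hb0 _ _ (fun h => hj (by rw [← h]; exact i.2.trans_le (min_le_left _ _)))]; simp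
  · intro i
    rw [smul_dotProduct, hWW, hsc, smul_eq_mul]
    by_cases h : s (c i) = 0
    · simp [h]
    · field_simp

theorem mul_rectDiagonal_mul_transpose (U : Matrix (Fin d₁) (Fin d₁) ℝ)
    (V : Matrix (Fin d₂) (Fin d₂) ℝ) (a : Fin (min d₁ d₂) → ℝ) :
    U * rectDiagonal a * Vᵀ = ∑ i, a i • vecMulVec (U.col (Fin.castLE (min_le_left _ _) i))
      (V.col (Fin.castLE (min_le_right _ _) i)) := by
  have h : rectDiagonal a = ∑ i, a i • vecMulVec
      (Pi.single (Fin.castLE (min_le_left d₁ d₂) i) (1 : ℝ))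
      (Pi.single (Fin.castLE (min_le_right d₁ d₂) i) (1 : ℝ)) := by
    ext j k
    simp only [rectDiagonal, of_apply, Matrix.sum_apply, Matrix.smul_apply, vecMulVec_apply, Pi.single_apply,
      smul_eq_mul, Fin.ext_iff, Fin.val_castLE]
    split_ifs with hjk
    · rw [Finset.sum_eq_single ⟨j, lt_min j.2 (hjk ▸ k.2)⟩]
      · simp [hjk]
      · intro i _ hi
        have : (j : ℕ) ≠ i := fun h => hi (Fin.ext h.symm)
        simp [this]
      · simp
    · rw [Finset.sum_eq_zero]
      intro i _
      by_cases h1 : (j : ℕ) = i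
      · have : ¬ (k : ℕ) = i := fun h => hjk (h1.trans h.symm)
        simp [this]
      · simp [h1]
  rw [h, Matrix.mul_sum, Matrix.sum_mul]
  refine Finset.sum_congr rfl fun i _ => ?_
  rw [Matrix.mul_smul, Matrix.smul_mul, mul_vecMulVec, vecMulVec_mul, mulVec_single_one,
    vecMul_transpose, mulVec_single_one]

theorem col_dotProduct_col_of_mem_orthogonalGroup {U : Matrix (Fin d₁) (Fin d₁) ℝ}
    (hU : U ∈ orthogonalGroup (Fin d₁) ℝ) (i j : Fin d₁) :
    U.col i ⬝ᵥ U.col j = (1 : Matrix (Fin d₁) (Fin d₁) ℝ) i j := by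
  rw [← (mem_orthogonalGroup_iff' _ _).1 hU, mul_apply]
  rfl

theorem IsSVD.isSingularSystem {W : Matrix (Fin d₁) (Fin d₂) ℝ} {U : Matrix (Fin d₁) (Fin d₁) ℝ}
    {V : Matrix (Fin d₂) (Fin d₂) ℝ} (h : IsSVD W U V) :
    IsSingularSystem W (singularValueVector W)
      (fun i => U.col (Fin.castLE (min_le_left _ _) i))
      (fun i => V.col (Fin.castLE (min_le_right _ _) i)) := by
  obtain ⟨hU, hV, hW⟩ := h
  have hcU := col_dotProduct_col_of_mem_orthogonalGroup hU
  have hcV := col_dotProduct_col_of_mem_orthogonalGroup hV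
  have hsum := hW.trans (mul_rectDiagonal_mul_transpose _ _ _)
  refine ⟨fun i => LinearMap.singularValues_nonneg _ _, ?_, ?_, hsum, fun i => ?_⟩
  · refine isBessel_of_dotProduct_eq_zero (fun i j hij => ?_) fun i => ?_
    · rw [hcU, one_apply_ne ((Fin.castLE_injective _).ne hij)]
    · rw [hcU, one_apply_eq]
  · refine isBessel_of_dotProduct_eq_zero (fun i j hij => ?_) fun i => ?_
    · rw [hcV, one_apply_ne ((Fin.castLE_injective _).ne hij)]
    · rw [hcV, one_apply_eq]
  · generalize singularValueVector W = s at *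
    rw [hsum, dotProduct_sum_smul_vecMulVec_mulVec, Finset.sum_eq_single i]
    · simp [hcU, hcV]
    · intro j _ hj
      rw [hcU, one_apply_ne ((Fin.castLE_injective _).ne hj)]; simp
    · simp

end Existence

theorem mainTheorem2 (d₁ d₂ : ℕ) (ε : ℝ) (hε : 0 < ε) :
    Differentiable ℝ (smoothedLogDet ε : Matrix (Fin d₁) (Fin d₂) ℝ → ℝ) ∧
    LipschitzWith 1 (∇ (smoothedLogDet ε : Matrix (Fin d₁) (Fin d₂) ℝ → ℝ)) ∧
    ∀ (W : Matrix (Fin d₁) (Fin d₂) ℝ) (U : Matrix (Fin d₁) (Fin d₁) ℝ)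
      (V : Matrix (Fin d₂) (Fin d₂) ℝ), IsSVD W U V →
      ∇ (smoothedLogDet ε) W =
        U * rectDiagonal (fun i =>
          singularValueVector W i / (max (singularValueVector W i / ε) 1) ^ 2) * V.transpose := by
  have bound : ∀ (W : Matrix (Fin d₁) (Fin d₂) ℝ) (u : Fin (min d₁ d₂) → Fin d₁ → ℝ)
      (v : Fin (min d₁ d₂) → Fin d₂ → ℝ), IsSingularSystem W (singularValueVector W) u v →
      ∀ Z, |smoothedLogDet ε Z - smoothedLogDet ε W -
        inner ℝ (∑ i, smoothedLogDeriv ε (singularValueVector W i) • vecMulVec (u i) (v i))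
          (Z - W)| ≤ 1 / 2 * ‖Z - W‖ ^ 2 := fun W u v hW Z => by
    obtain ⟨p, q, hZ⟩ := exists_isSingularSystem Z
    exact hW.abs_sum_smoothedLog_sub_le hε hZ
  have grad : ∀ W : Matrix (Fin d₁) (Fin d₂) ℝ, ∃ u v,
      IsSingularSystem W (singularValueVector W) u v ∧ HasGradientAt (smoothedLogDet ε)
        (∑ i, smoothedLogDeriv ε (singularValueVector W i) • vecMulVec (u i) (v i)) W :=
    fun W => by
      obtain ⟨u, v, h⟩ := exists_isSingularSystem W
      exact ⟨u, v, h, hasGradientAt_of_abs_sub_sub_inner_le (bound W u v h)⟩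
  refine ⟨fun W => ?_, lipschitzWith_one_of_abs_sub_sub_inner_le (F := smoothedLogDet ε)
    fun W Z => ?_, fun W U V h => ?_⟩
  · obtain ⟨u, v, -, h⟩ := grad W
    exact h.differentiableAt
  · obtain ⟨u, v, h, hg⟩ := grad W
    rw [hg.gradient]
    exact bound W u v h Z
  · rw [mul_rectDiagonal_mul_transpose]
    exact (hasGradientAt_of_abs_sub_sub_inner_le (bound W _ _ h.isSingularSystem)).gradient
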